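/- Let $m$ and $n$ be coprime positive integers. **Billiard symbol.** In a rectangle of width $n$ and height $m$ with lower left corner at the origin, a ball starts at $(0,0)$ and moves at $45^\circ$ to the sides, reflecting off each side it hits, until it first reaches a corner again, where the path ends. A bounce along the base (the side on the $x$-axis; the start and the end of the path are not bounces) is positive if the ball is moving from left to right as it bounces, and negative if it is moving from right to left. Let $\left(\frac{m}{n}\right)\in\{1,-1\}$ be the product of the signs of all bounces along the base (an empty product is $1$). **Puzzle.** Consider a checkerboard with $m-1$ rows and $n-1$ columns whose lower left square is dark, and put pebbles on all light squares of the bottom row. A solution is a set of dark squares, on which checkers are put, such that the light squares with an odd number of checkers on the squares sharing a side with them are precisely the squares with pebbles. Then this puzzle has exactly one solution, and if $s$ is the number of checkers in it, then \[ \left(\frac{m}{n}\right) = (-1)^s . \] -/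

import Mathlib

/-! ### Arithmetic billiards -/

/-- A moving ball: its position `(x, y)` at an integer time and its direction `(dx, dy)` of
motion right after that time (that is, after a possible bounce); `dx, dy` are `1` or `-1`. -/
structure Ball where
  x : ℤ
  y : ℤ
  dx : ℤ
  dy : ℤ

/-- The ball in the lower left corner `(0, 0)`, moving up and to the right. -/
def Ball.start : Ball := ⟨0, 0, 1, 1⟩

/-- One unit of time in a rectangle of height `m` and width `n`: the ball moves along one diagonal
of a unit square; if it is then on a vertical (horizontal) side of the rectangle, its horizontal
(vertical) direction is reversed. All bounces occur at integer times. -/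
def Ball.step (m n : ℕ) (b : Ball) : Ball where
  x := b.x + b.dx
  y := b.y + b.dy
  dx := if b.x + b.dx = 0 ∨ b.x + b.dx = n then -b.dx else b.dx
  dy := if b.y + b.dy = 0 ∨ b.y + b.dy = m then -b.dy else b.dy

/-- The ball at time `t`, in a rectangle of height `m` and width `n`. -/
def ballAt (m n t : ℕ) : Ball := (Ball.step m n)^[t] Ball.start

/-- The ball is in one of the four corners of the rectangle. -/
def Ball.AtCorner (m n : ℕ) (b : Ball) : Prop :=
  (b.x = 0 ∨ b.x = n) ∧ (b.y = 0 ∨ b.y = m)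

/-- The time at which the path is completed: the first positive time at which the ball is in a
corner (for positive `m` and `n` there is such a time). -/
noncomputable def endTime (m n : ℕ) : ℕ :=
  sInf {t : ℕ | 0 < t ∧ (ballAt m n t).AtCorner m n}

/-- The times of the bounces along the base (the `x`-axis); neither the start nor the end of the
path is a bounce. -/
noncomputable def baseBounceTimes (m n : ℕ) : Finset ℕ :=
  (Finset.Ioo 0 (endTime m n)).filter fun t => (ballAt m n t).y = 0

/-- The sign of a bounce along the base: positive if the ball moves from left to right as it
bounces, negative if it moves from right to left. (The horizontal direction does not change at
such a bounce.) -/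
def bounceSign (m n t : ℕ) : ℤ := if 0 < (ballAt m n t).dx then 1 else -1

/-- The billiard symbol `(m|n)`: the product of the signs of the bounces along the base if `m` and
`n` are coprime, and `0` otherwise. -/
noncomputable def billiardSymbol (m n : ℕ) : ℤ :=
  if Nat.Coprime m n then ∏ t ∈ baseBounceTimes m n, bounceSign m n t else 0

/-! ### Parity checkers -/

/-- The squares `(row, column)` of a board with `r` rows and `c` columns; rows are counted from the
bottom and columns from the left, both starting at `0`. -/
abbrev Square (r c : ℕ) : Type := Fin r × Fin c

/-- The dark squares of the checkerboard whose lower left square is dark. -/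
abbrev IsDark {r c : ℕ} (q : Square r c) : Prop := Even (q.1.val + q.2.val)

/-- The light squares. -/
abbrev IsLight {r c : ℕ} (q : Square r c) : Prop := ¬ IsDark q

/-- Two squares are neighbours if they share a side. -/
abbrev Neighbour {r c : ℕ} (p q : Square r c) : Prop :=
  (p.1 = q.1 ∧ (p.2.val + 1 = q.2.val ∨ q.2.val + 1 = p.2.val)) ∨
  (p.2 = q.2 ∧ (p.1.val + 1 = q.1.val ∨ q.1.val + 1 = p.1.val))

/-- The set `C` of checkers solves the puzzle with pebbles on the set `P` of light squares: all
checkers are on dark squares, and the light squares with an odd number of neighbouring checkers are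
precisely those with pebbles. -/
def IsSolution {r c : ℕ} (P C : Finset (Square r c)) : Prop :=
  (∀ q ∈ C, IsDark q) ∧
  ∀ q : Square r c, IsLight q → (Odd (C.filter fun d => Neighbour q d).card ↔ q ∈ P)

/-- The puzzle with pebbles on all light squares of the bottom row. -/
def bottomRowPuzzle (r c : ℕ) : Finset (Square r c) :=
  Finset.univ.filter fun q => IsLight q ∧ q.1.val = 0

/-! Unfolding the reflections puts the ball at `(fold n t, fold m t)` at time `t`; it stops at time
`mn`. It meets the base at the times `2mk` with `0 < 2k < n`, and the sign there is the parity of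
`⌊2mk/n⌋`. Hence the symbol is `(-1)^S` with `S = ∑ ⌊2mk/n⌋` (`billiardSymbol_eq`).

A solution is explicit: label each segment of the path by the number of base bounces before it, mod
2, and put a checker wherever segments with different labels cross (`isSolution_crossingSet`). The
four neighbours of a light square lie in pairs on four lines, so labels cancel; only base points
have value 1 without carrying a checker, which produces the pebbles. The difference of two solutions
satisfies a wave equation mod 2 with zero boundary values, and coprimality forces it to vanish
(`wave_eq_zero`).

The path passes each dark square twice, so mod 2 the number of checkers is the sum of the labels
`⌊t/2m⌋` over the interior times `t < mn`. Adding `∑ ⌊nj/2m⌋` over `0 < j < m` to this sum and to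
`S` gives two closed forms that agree mod 2 (`sum_interiorTimes_eq_sum_bounceIndices`). -/

/-! ### The path of the ball -/

/-- The point of `[0, n]` obtained from the integer `t` by reflections in the multiples of `n`. -/
def fold (n : ℕ) (t : ℤ) : ℤ := if t % (2 * n) ≤ n then t % (2 * n) else 2 * n - t % (2 * n)

lemma emod_bounds {n : ℕ} (hn : 0 < n) (t : ℤ) : 0 ≤ t % (2 * n) ∧ t % (2 * n) < 2 * n :=
  ⟨Int.emod_nonneg _ (by omega), Int.emod_lt_of_pos _ (by omega)⟩

lemma add_one_emod {n : ℕ} (hn : 0 < n) (t : ℤ) :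
    (t + 1) % (2 * n) = if t % (2 * n) + 1 = 2 * n then 0 else t % (2 * n) + 1 := by
  have h := emod_bounds hn t
  rw [Int.add_emod, Int.emod_eq_of_lt (a := 1) (by omega) (by omega)]
  split_ifs with h1
  · rw [h1, Int.emod_self]
  · exact Int.emod_eq_of_lt (by omega) (by omega)

lemma fold_add_one {n : ℕ} (hn : 0 < n) (t : ℤ) :
    fold n (t + 1) = fold n t + if t % (2 * n) < n then 1 else -1 := by
  have h := emod_bounds hn t
  unfold fold
  rw [add_one_emod hn]
  split_ifs <;> omega

lemma dvd_iff_emod {n : ℕ} (hn : 0 < n) (t : ℤ) :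
    (n : ℤ) ∣ t ↔ t % (2 * n) = 0 ∨ t % (2 * n) = n := by
  have h := emod_bounds hn t
  have e := Int.emod_add_mul_ediv t (2 * n)
  constructor
  · rintro ⟨c, rfl⟩
    have : (n : ℤ) * c % (2 * n) = n * (c % 2) := by
      rw [mul_comm 2 (n : ℤ), Int.mul_emod_mul_of_pos _ _ (by omega)]
    rw [this]
    rcases Int.emod_two_eq_zero_or_one c with h | h <;> simp [h]
  · rintro (h | h)
    · exact ⟨2 * (t / (2 * n)), by linarith⟩
    · exact ⟨1 + 2 * (t / (2 * n)), by linarith⟩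

lemma fold_eq_zero_or_iff {n : ℕ} (hn : 0 < n) (t : ℤ) :
    (fold n t = 0 ∨ fold n t = n) ↔ (n : ℤ) ∣ t := by
  have h := emod_bounds hn t
  rw [dvd_iff_emod hn]
  unfold fold
  split_ifs <;> omega

lemma fold_eq_zero_iff {n : ℕ} (hn : 0 < n) (t : ℤ) : fold n t = 0 ↔ (2 * n : ℤ) ∣ t := by
  have h := emod_bounds hn t
  rw [Int.dvd_iff_emod_eq_zero]
  unfold fold
  split_ifs <;> omega

lemma fold_mem {n : ℕ} (hn : 0 < n) (t : ℤ) : 0 ≤ fold n t ∧ fold n t ≤ n := by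
  have h := emod_bounds hn t
  unfold fold
  split_ifs <;> omega

lemma ballAt_eq {m n : ℕ} (hm : 0 < m) (hn : 0 < n) (t : ℕ) :
    ballAt m n t = ⟨fold n t, fold m t, if (t : ℤ) % (2 * n) < n then 1 else -1,
      if (t : ℤ) % (2 * m) < m then 1 else -1⟩ := by
  induction t with
  | zero => simp [ballAt, Ball.start, fold, hm, hn]
  | succ t ih =>
    have key : ∀ {n : ℕ}, 0 < n →
        (if fold n ((t : ℤ) + 1) = 0 ∨ fold n ((t : ℤ) + 1) = n
          then -(if (t : ℤ) % (2 * n) < n then (1 : ℤ) else -1)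
          else (if (t : ℤ) % (2 * n) < n then 1 else -1)) =
        if ((t : ℤ) + 1) % (2 * n) < n then 1 else -1 := by
      intro n hn
      rw [fold_add_one hn, add_one_emod hn]
      have h := emod_bounds hn t
      unfold fold
      split_ifs <;> omega
    have e : ballAt m n (t + 1) = Ball.step m n (ballAt m n t) :=
      Function.iterate_succ_apply' _ _ _
    rw [e, ih]
    simp only [Ball.step, ← fold_add_one hn, ← fold_add_one hm, key hn, key hm, Nat.cast_succ]

lemma endTime_eq {m n : ℕ} (hm : 0 < m) (hn : 0 < n) (hmn : Nat.Coprime m n) :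
    endTime m n = m * n := by
  have h : {t : ℕ | 0 < t ∧ (ballAt m n t).AtCorner m n} = {t : ℕ | 0 < t ∧ m * n ∣ t} := by
    ext t
    simp only [Ball.AtCorner, ballAt_eq hm hn, fold_eq_zero_or_iff hm, fold_eq_zero_or_iff hn,
      Set.mem_ofPred_eq, Int.natCast_dvd_natCast]
    constructor
    · rintro ⟨h0, h1, h2⟩
      exact ⟨h0, hmn.mul_dvd_of_dvd_of_dvd h2 h1⟩
    · rintro ⟨h0, h⟩
      exact ⟨h0, (Dvd.intro_left _ rfl).trans h, (Dvd.intro _ rfl).trans h⟩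
  rw [endTime, h]
  refine le_antisymm (Nat.sInf_le ⟨by positivity, dvd_rfl⟩) ?_
  refine le_csInf ⟨m * n, by positivity, dvd_rfl⟩ ?_
  rintro t ⟨h0, h1⟩
  exact Nat.le_of_dvd h0 h1

/-- `t / n` counts the reflections in vertical sides up to time `t`. -/
lemma neg_one_pow_div_eq {n : ℕ} (hn : 0 < n) (t : ℕ) :
    (-1 : ℤ) ^ (t / n) = if (t : ℤ) % (2 * n) < n then 1 else -1 := by
  have h1 : (t : ℤ) % (2 * n) = ((t % (2 * n) : ℕ) : ℤ) := by push_cast; rfl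
  have h2 : t % (2 * n) = t % n + n * (t / n % 2) := by rw [mul_comm 2 n, Nat.mod_mul]
  have h3 := Nat.mod_lt t hn
  rw [h1, h2]
  rcases Nat.mod_two_eq_zero_or_one (t / n) with h | h
  · rw [(Nat.even_iff.2 h).neg_one_pow, if_pos (by rw [h]; push_cast; omega)]
  · rw [(Nat.odd_iff.2 h).neg_one_pow, if_neg (by rw [h]; push_cast; omega)]

/-- The indices of the bounces along the base: the `k`-th one happens at time `2 * m * k`. -/
def bounceIndices (n : ℕ) : Finset ℕ := (Finset.Ioo 0 n).filter fun k => 2 * k < n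

theorem billiardSymbol_eq {m n : ℕ} (hm : 0 < m) (hn : 0 < n) (hmn : Nat.Coprime m n) :
    billiardSymbol m n = (-1) ^ ∑ k ∈ bounceIndices n, (2 * m * k) / n := by
  rw [billiardSymbol, if_pos hmn, ← Finset.prod_pow_eq_pow_sum]
  refine Finset.prod_nbij' (· / (2 * m)) (2 * m * ·) ?_ ?_ ?_ ?_ ?_
  all_goals simp only [baseBounceTimes, bounceIndices, Finset.mem_filter, Finset.mem_Ioo,
    endTime_eq hm hn hmn, ballAt_eq hm hn, fold_eq_zero_iff hm, bounceSign]
  · rintro t ⟨⟨h0, h1⟩, h2⟩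
    obtain ⟨k, rfl⟩ : 2 * m ∣ t := by exact_mod_cast h2
    rw [Nat.mul_div_cancel_left _ (by omega)]
    have : 2 * k < n := by nlinarith
    have : 0 < k := Nat.pos_of_ne_zero (by rintro rfl; simp at h0)
    omega
  · rintro k ⟨⟨h0, h1⟩, h2⟩
    refine ⟨⟨by positivity, by nlinarith⟩, k, by push_cast; ring⟩
  · rintro t ⟨-, h2⟩
    exact Nat.mul_div_cancel' (by exact_mod_cast h2)
  · intro k _
    exact Nat.mul_div_cancel_left _ (by omega)
  · rintro t ⟨-, h2⟩
    rw [Nat.mul_div_cancel' (by exact_mod_cast h2), neg_one_pow_div_eq hn]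
    split_ifs <;> simp_all

/-! ### Uniqueness of the solution -/

lemma dvd_fold_sub_or_add (n : ℕ) (t : ℤ) :
    (2 * n : ℤ) ∣ fold n t - t ∨ (2 * n : ℤ) ∣ fold n t + t := by
  have e := Int.emod_add_mul_ediv t (2 * n)
  unfold fold
  split_ifs
  · exact .inl ⟨-(t / (2 * n)), by linarith⟩
  · exact .inr ⟨1 + t / (2 * n), by linarith⟩

lemma even_fold_iff (n : ℕ) (t : ℤ) : Even (fold n t) ↔ Even t := by
  rcases dvd_fold_sub_or_add n t with h | h
  · exact Int.even_sub.1 (even_iff_two_dvd.2 ((Dvd.intro _ rfl).trans h))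
  · exact Int.even_add.1 (even_iff_two_dvd.2 ((Dvd.intro _ rfl).trans h))

lemma fold_of_mem {n : ℕ} {t : ℤ} (h0 : 0 ≤ t) (h1 : t ≤ n) : fold n t = t := by
  rcases Nat.eq_zero_or_pos n with rfl | hn
  · obtain rfl : t = 0 := by simp at h1; omega
    simp [fold]
  · unfold fold
    rw [Int.emod_eq_of_lt h0 (by omega), if_pos h1]

lemma fold_add_period (n : ℕ) (t : ℤ) : fold n (t + 2 * n) = fold n t := by simp [fold]

/-- On a side the two neighbours fold together, so their values cancel mod 2; elsewhere folding is a
local isometry. -/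
lemma fold_neighbours {n : ℕ} (hn : 0 < n) (t : ℤ) :
    ((n : ℤ) ∣ t → fold n (t + 1) = fold n (t - 1)) ∧
    (¬ (n : ℤ) ∣ t → fold n (t + 1) = fold n t + 1 ∧ fold n (t - 1) = fold n t - 1 ∨
      fold n (t + 1) = fold n t - 1 ∧ fold n (t - 1) = fold n t + 1) := by
  have h := emod_bounds hn (t - 1)
  have e1 := fold_add_one hn (t - 1)
  have e2 := fold_add_one hn t
  have e3 := add_one_emod hn (t - 1)
  rw [sub_add_cancel] at e1 e3
  rw [dvd_iff_emod hn]
  rw [e2, e1, e3]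
  split_ifs <;> omega

/-- A function modulo `2` on the even points of the plane that satisfies the wave equation and
has the periods `(2n, 0)` and `(0, 2m)` is zero if it vanishes on the lines `x = 0`, `y = 0`,
`x = n` and `y = m`. -/
lemma wave_eq_zero {m n : ℕ} (hmn : Nat.Coprime m n) (F : ℤ → ℤ → ZMod 2)
    (hx : ∀ y, F 0 y = 0) (hy : ∀ x, F x 0 = 0) (hxn : ∀ y, F n y = 0) (hym : ∀ x, F x m = 0)
    (px : ∀ x y, F (x + 2 * n) y = F x y) (py : ∀ x y, F x (y + 2 * m) = F x y)
    (wave : ∀ x y, Odd (x + y) → F (x + 1) y + F (x - 1) y + F x (y + 1) + F x (y - 1) = 0)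
    (x y : ℤ) (hxy : Even (x + y)) : F x y = 0 := by
  -- `d` is the increment along a diagonal; the wave equation says that it is constant along
  -- antidiagonals.
  set d : ℤ → ℤ → ZMod 2 := fun x y => F (x + 1) (y + 1) + F x y with hd
  have two (a : ZMod 2) : a + a = 0 := CharTwo.add_self_eq_zero a
  have d_step (x y : ℤ) (h : Even (x + y)) : d (x + 1) (y - 1) = d x y := by
    have := wave (x + 1) y (by rw [add_right_comm]; exact h.add_one)
    simp only [hd]
    rw [show x + 1 - 1 = x by ring] at this
    rw [show y - 1 + 1 = y by ring]
    linear_combination this - two (F x y) - two (F (x + 1) (y + 1))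
  have d_shift_nat (k : ℕ) : ∀ x y : ℤ, Even (x + y) → d (x + k) (y - k) = d x y := by
    induction k with
    | zero => simp
    | succ k ih =>
      intro x y h
      rw [← ih x y h, ← d_step (x + k) (y - k) (by simpa using h)]
      push_cast
      congr 1 <;> ring
  have d_shift (k x y : ℤ) (h : Even (x + y)) : d (x + k) (y - k) = d x y := by
    obtain ⟨k, rfl | rfl⟩ := k.eq_nat_or_neg
    · exact d_shift_nat k x y h
    · rw [← d_shift_nat k (x + -k) (y - -k)
        (by rw [add_add_sub_cancel]; exact h)]
      congr 1 <;> ring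
  have d_n (x y : ℤ) : d (x + 2 * n) y = d x y := by
    simp only [hd, px]
    rw [add_right_comm, px]
  -- Sliding along an antidiagonal turns the vertical period `2m` into a horizontal one; with the
  -- period `2n`, Bézout then gives the period 2.
  have d_m (x y : ℤ) (h : Even (x + y)) : d (x + 2 * m) y = d x y := by
    have := d_shift (2 * m) x (y + 2 * m) (by rw [← add_assoc]; exact h.add (even_two_mul _))
    rw [add_sub_cancel_right] at this
    rw [this]
    simp only [hd, py]
    rw [add_right_comm, py]
  have per (p : ℤ) (hp : ∀ x y, Even (x + y) → d (x + 2 * p) y = d x y) (k x y : ℤ)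
      (h : Even (x + y)) : d (x + 2 * (p * k)) y = d x y := by
    induction k with
    | zero => simp
    | succ k ih =>
      rw [← ih, ← hp (x + 2 * (p * k)) y (by rw [add_right_comm]; exact h.add (even_two_mul _))]
      congr 1; ring
    | pred k ih =>
      rw [← ih, ← hp (x + 2 * (p * (-k - 1))) y
        (by rw [add_right_comm]; exact h.add (even_two_mul _))]
      congr 1; ring
  have d_two (x y : ℤ) (h : Even (x + y)) : d (x + 2) y = d x y := by
    have bez := Nat.gcd_eq_gcd_ab m n
    rw [hmn.gcd_eq_one] at bez
    have h' : Even (x + 2 * (m * m.gcdA n) + y) := by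
      rw [add_right_comm]; exact h.add (even_two_mul _)
    rw [← per m d_m (m.gcdA n) x y h, ← per n (fun x y _ => d_n x y) (m.gcdB n) _ y h']
    congr 1
    push_cast at bez
    linear_combination 2 * bez
  have d_const (x y : ℤ) (h : Even (x + y)) : d x y = d 0 0 := by
    have h1 := d_shift (-x) x y h
    obtain ⟨k, hk⟩ := h
    have h2 := per 1 (by simpa using d_two) k 0 0 (by simp)
    have h3 := d_shift (2 * k) 0 (2 * k) (by simp)
    rw [show y - -x = 2 * k by linarith, add_neg_cancel] at h1
    rw [sub_self, ← one_mul k, h2, one_mul] at h3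
    rw [← h1, h3]
  have diag (k : ℕ) : F k k = k * d 0 0 := by
    induction k with
    | zero => simp [hx]
    | succ k ih =>
      have := d_const k k (by simp)
      push_cast
      rw [← this] at ih ⊢
      simp only [hd] at ih ⊢
      linear_combination ih - two (F k k)
  -- One of `m`, `n` is odd, and `F` vanishes at both `(n, n)` and `(m, m)`.
  have hc : d 0 0 = 0 := by
    have h1 := diag n
    have h2 := diag m
    rw [hxn] at h1
    rw [hym] at h2
    rcases Nat.even_or_odd n with h | h
    · have : Odd m := by
        rw [← Nat.not_even_iff_odd]
        intro h'
        exact absurd (Nat.dvd_gcd h'.two_dvd h.two_dvd) (by rw [hmn.gcd_eq_one]; decide)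
      rw [(ZMod.natCast_eq_one_iff_odd).2 this, one_mul] at h2
      exact h2.symm
    · rw [(ZMod.natCast_eq_one_iff_odd).2 h, one_mul] at h1
      exact h1.symm
  have F_diag (x y : ℤ) (h : Even (x + y)) : F (x + 1) (y + 1) = F x y := by
    have := d_const x y h
    rw [hc] at this
    exact CharTwo.add_eq_zero.1 this
  -- Now `F` is constant along diagonals, and each diagonal meets the line `y = 0`.
  have F_nat (k : ℕ) : ∀ x : ℤ, Even x → F (x + k) k = 0 := by
    induction k with
    | zero => simp [hy]
    | succ k ih =>
      intro x h
      rw [← ih x h, ← F_diag (x + k) k (by rw [add_assoc]; exact h.add (Even.add_self _))]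
      push_cast
      congr 1; ring
  have F_neg (k : ℕ) : ∀ x : ℤ, Even x → F (x - k) (-k) = 0 := by
    induction k with
    | zero => simp [hy]
    | succ k ih =>
      intro x h
      rw [← ih x h, ← F_diag]
      · push_cast
        congr 1 <;> ring
      · push_cast
        rw [show x - ((k : ℤ) + 1) + -((k : ℤ) + 1) = x - 2 * (k + 1) by ring]
        exact h.sub (even_two_mul _)
  have hs : Even (x - y) := Int.even_sub.2 (Int.even_add.1 hxy)
  obtain ⟨k, rfl | rfl⟩ := y.eq_nat_or_neg
  · simpa using F_nat k _ hs
  · simpa using F_neg k _ hs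

/-- A function modulo `2` on the rectangle that vanishes on the boundary and satisfies the wave
equation at the odd interior points vanishes at the even points. -/
lemma wave_eq_zero_of_boundary {m n : ℕ} (hm : 0 < m) (hn : 0 < n) (hmn : Nat.Coprime m n)
    (f : ℤ → ℤ → ZMod 2)
    (hb : ∀ x y : ℤ, ¬ (0 < x ∧ x < n ∧ 0 < y ∧ y < m) → f x y = 0)
    (wave : ∀ x y : ℤ, 0 < x → x < n → 0 < y → y < m → Odd (x + y) →
      f (x + 1) y + f (x - 1) y + f x (y + 1) + f x (y - 1) = 0)
    (x y : ℤ) (hxy : Even (x + y)) : f x y = 0 := by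
  by_cases hin : 0 < x ∧ x < n ∧ 0 < y ∧ y < m
  swap
  · exact hb x y hin
  have two (a : ZMod 2) : a + a = 0 := CharTwo.add_self_eq_zero a
  have vx (x y : ℤ) (h : (n : ℤ) ∣ x) : f (fold n x) (fold m y) = 0 := by
    have := (fold_eq_zero_or_iff hn x).2 h
    exact hb _ _ (by omega)
  have vy (x y : ℤ) (h : (m : ℤ) ∣ y) : f (fold n x) (fold m y) = 0 := by
    have := (fold_eq_zero_or_iff hm y).2 h
    exact hb _ _ (by omega)
  -- Extension by reflection; mod 2 an odd extension needs no sign.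
  have key := wave_eq_zero hmn (fun x y => f (fold n x) (fold m y))
    (fun y => vx _ _ (dvd_zero _)) (fun x => vy _ _ (dvd_zero _))
    (fun y => vx _ _ dvd_rfl) (fun x => vy _ _ dvd_rfl)
    (fun x y => by simp only [fold_add_period]) (fun x y => by simp only [fold_add_period])
    ?_ x y hxy
  · rw [fold_of_mem, fold_of_mem] at key <;> first | exact key | omega
  intro x y hodd
  have ex := fold_neighbours hn x
  have ey := fold_neighbours hm y
  by_cases h1 : (n : ℤ) ∣ x
  · simp only [ex.1 h1, vx x _ h1, two]
  by_cases h2 : (m : ℤ) ∣ y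
  · simp only [ey.1 h2, vy _ y h2, zero_add, two]
  have bx := fold_mem hn x
  have by' := fold_mem hm y
  have nx := (fold_eq_zero_or_iff hn x).not.2 h1
  have ny := (fold_eq_zero_or_iff hm y).not.2 h2
  have w := wave (fold n x) (fold m y) (by omega) (by omega) (by omega) (by omega) (by
    rw [← Int.not_even_iff_odd, Int.even_add, even_fold_iff, even_fold_iff, ← Int.even_add,
      Int.not_even_iff_odd]
    exact hodd)
  rcases ex.2 h1 with ⟨e1, e2⟩ | ⟨e1, e2⟩ <;> rcases ey.2 h2 with ⟨e3, e4⟩ | ⟨e3, e4⟩ <;>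
    simp only [e1, e2, e3, e4] <;> rw [← w] <;> ring

/-! ### The puzzle as a wave equation -/

/-- The number modulo `2` of checkers of `C` at the point `(x, y)`, where the square in row `i` and
column `j` is the point `(j + 1, i + 1)`. -/
def checkerAt {r c : ℕ} (C : Finset (Square r c)) (x y : ℤ) : ZMod 2 :=
  ∑ d ∈ C, if (d.2.val : ℤ) + 1 = x ∧ (d.1.val : ℤ) + 1 = y then 1 else 0

lemma checkerAt_square {r c : ℕ} (C : Finset (Square r c)) (q : Square r c) :
    checkerAt C (q.2.val + 1) (q.1.val + 1) = if q ∈ C then 1 else 0 := by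
  have (d : Square r c) : ((d.2.val : ℤ) + 1 = q.2.val + 1 ∧ (d.1.val : ℤ) + 1 = q.1.val + 1) ↔
      d = q := by
    rw [Prod.ext_iff, Fin.ext_iff, Fin.ext_iff]
    omega
  simp only [checkerAt, this, Finset.sum_ite_eq']

lemma exists_square {r c : ℕ} {x y : ℤ} (h1 : 0 < x) (h2 : x ≤ c) (h3 : 0 < y) (h4 : y ≤ r) :
    ∃ q : Square r c, x = q.2.val + 1 ∧ y = q.1.val + 1 :=
  ⟨(⟨(y - 1).toNat, by omega⟩, ⟨(x - 1).toNat, by omega⟩), by dsimp; omega, by dsimp; omega⟩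

lemma checkerAt_outside {r c : ℕ} (C : Finset (Square r c)) (x y : ℤ)
    (h : ¬ (0 < x ∧ x ≤ c ∧ 0 < y ∧ y ≤ r)) : checkerAt C x y = 0 := by
  refine Finset.sum_eq_zero fun d _ => if_neg ?_
  have := d.1.isLt
  have := d.2.isLt
  omega

lemma card_neighbours {r c : ℕ} (C : Finset (Square r c)) (q : Square r c) :
    ((C.filter fun d => Neighbour q d).card : ZMod 2) =
      checkerAt C (q.2.val + 1 + 1) (q.1.val + 1) + checkerAt C (q.2.val + 1 - 1) (q.1.val + 1) +
      checkerAt C (q.2.val + 1) (q.1.val + 1 + 1) + checkerAt C (q.2.val + 1) (q.1.val + 1 - 1) := by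
  simp only [checkerAt, ← Finset.sum_add_distrib, Finset.natCast_card_filter]
  refine Finset.sum_congr rfl fun d _ => ?_
  simp only [Neighbour, Fin.ext_iff]
  split_ifs <;> first | omega | simp

/-- Shifting the coordinates by `(1, 1)` keeps the colours and leaves the sides of the billiard
table free as a boundary without checkers. -/
lemma isSolution_iff {r c : ℕ} (C : Finset (Square r c)) :
    IsSolution (bottomRowPuzzle r c) C ↔ (∀ q ∈ C, IsDark q) ∧
      ∀ x y : ℤ, 0 < x → x ≤ c → 0 < y → y ≤ r → Odd (x + y) →
        checkerAt C (x + 1) y + checkerAt C (x - 1) y + checkerAt C x (y + 1) +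
          checkerAt C x (y - 1) = if y = 1 then 1 else 0 := by
  have light (q : Square r c) :
      IsLight q ↔ Odd ((q.2.val + 1 : ℤ) + (q.1.val + 1)) := by
    rw [IsLight, IsDark, Nat.not_even_iff, Int.odd_iff]
    omega
  have bool (q : Square r c) (hq : IsLight q) (a : ℕ) :
      (Odd a ↔ q ∈ bottomRowPuzzle r c) ↔
        (a : ZMod 2) = if (q.1.val + 1 : ℤ) = 1 then 1 else 0 := by
    have : (q.1.val + 1 : ℤ) = 1 ↔ q.1.val = 0 := by omega
    have mem : q ∈ bottomRowPuzzle r c ↔ q.1.val = 0 := by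
      rw [bottomRowPuzzle, Finset.mem_filter]
      exact ⟨fun h => h.2.2, fun h => ⟨Finset.mem_univ q, hq, h⟩⟩
    rw [mem]
    simp only [this]
    split_ifs with h
    · rw [ZMod.natCast_eq_one_iff_odd]; simp [h]
    · rw [ZMod.natCast_eq_zero_iff_even, ← Nat.not_odd_iff_even]; simp [h]
  refine and_congr_right fun _ => ⟨fun h x y h1 h2 h3 h4 hodd => ?_, fun h q hq => ?_⟩
  · obtain ⟨q, rfl, rfl⟩ := exists_square h1 h2 h3 h4
    have hq := (light q).2 hodd
    rw [← card_neighbours]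
    exact (bool q hq _).1 (h q hq)
  · rw [bool q hq, card_neighbours]
    have := q.1.isLt
    have := q.2.isLt
    exact h _ _ (by omega) (by omega) (by omega) (by omega) ((light q).1 hq)

lemma eq_of_isSolution {m n : ℕ} (hm : 0 < m) (hn : 0 < n) (hmn : Nat.Coprime m n)
    {C D : Finset (Square (m - 1) (n - 1))}
    (hC : IsSolution (bottomRowPuzzle (m - 1) (n - 1)) C)
    (hD : IsSolution (bottomRowPuzzle (m - 1) (n - 1)) D) : C = D := by
  rw [isSolution_iff] at hC hD
  have key := wave_eq_zero_of_boundary hm hn hmn (fun x y => checkerAt C x y - checkerAt D x y)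
    (fun x y h => by rw [checkerAt_outside, checkerAt_outside, sub_self] <;> omega)
    (fun x y h1 h2 h3 h4 hodd => by
      have e1 := hC.2 x y h1 (by omega) h3 (by omega) hodd
      have e2 := hD.2 x y h1 (by omega) h3 (by omega) hodd
      linear_combination e1 - e2)
  ext q
  by_cases hq : IsDark q
  · have := key (q.2.val + 1) (q.1.val + 1) (by
      rw [IsDark, Nat.even_iff] at hq
      rw [Int.even_iff]
      omega)
    simp only [checkerAt_square] at this
    by_cases h1 : q ∈ C <;> by_cases h2 : q ∈ D <;> simp_all
  · exact ⟨fun h => absurd (hC.1 q h) hq, fun h => absurd (hD.1 q h) hq⟩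

/-! ### Existence of the solution -/

/-- Labels modulo `2` of the line segments of the path of the ball: the label changes at each bounce
along the base. The unfolded line `x - y = 2 * j` has the label `lineLabel m n j`. -/
def lineLabel (m n : ℕ) (j : ℤ) : ZMod 2 :=
  ((min ((m : ZMod n)⁻¹ * j).val (n - 1 - ((m : ZMod n)⁻¹ * j).val) : ℕ) : ZMod 2)

/-- At time `t` the unfolded ball is at `(t % 2n, t % 2m)`, on a line with `j ≡ mk` mod `n`, where
`k = t / (2m)` counts the visits to the base after the start. The way back exchanges `k` and `n - 1
- k`, hence the minimum. -/
lemma lineLabel_eq {m n : ℕ} (hmn : Nat.Coprime m n) {k : ℕ} (hk : k < n) {j : ℤ}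
    (h : (n : ℤ) ∣ j - m * k) : lineLabel m n j = (min k (n - 1 - k) : ℕ) := by
  have : ((m : ZMod n)⁻¹ * j).val = k := by
    have e : (j : ZMod n) = m * k := by
      rw [← sub_eq_zero]
      exact_mod_cast (ZMod.intCast_zmod_eq_zero_iff_dvd _ n).2 h
    rw [e, ← mul_assoc, mul_comm _ (m : ZMod n), ZMod.coe_mul_inv_eq_one m hmn, one_mul,
      ZMod.val_cast_of_lt hk]
  rw [lineLabel, this]

lemma exists_index {m n : ℕ} (hn : 0 < n) (hmn : Nat.Coprime m n) (j : ℤ) :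
    ∃ k < n, (n : ℤ) ∣ j - m * k := by
  have : NeZero n := ⟨hn.ne'⟩
  refine ⟨((m : ZMod n)⁻¹ * j).val, ZMod.val_lt _, ?_⟩
  rw [← ZMod.intCast_zmod_eq_zero_iff_dvd]
  push_cast
  rw [ZMod.natCast_val, ZMod.cast_id, ← mul_assoc, ZMod.coe_mul_inv_eq_one m hmn, one_mul, sub_self]

lemma lineLabel_add_self (m n : ℕ) (j : ℤ) : lineLabel m n (j + n) = lineLabel m n j := by
  simp [lineLabel]

lemma lineLabel_reflect {m n : ℕ} (hn : 0 < n) (hmn : Nat.Coprime m n) (j : ℤ) :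
    lineLabel m n (-m - j) = lineLabel m n j := by
  obtain ⟨k, hk, h⟩ := exists_index hn hmn j
  rw [lineLabel_eq hmn hk h, lineLabel_eq hmn (k := n - 1 - k) (by omega)]
  · congr 1; omega
  · obtain ⟨c, hc⟩ := h
    refine ⟨-c - m, ?_⟩
    rw [Nat.cast_sub (by omega), Nat.cast_sub (by omega)]
    push_cast
    linear_combination -hc

/-- The lines `j` and `-j` meet the base at the same folded point, and their indices are `k` and `n
- k`. The hypothesis excludes the corners, where `k = 0` or `2k = n`. -/
lemma lineLabel_add_neg {m n : ℕ} (hn : 0 < n) (hmn : Nat.Coprime m n) {j : ℤ}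
    (hj : ¬ (n : ℤ) ∣ 2 * j) : lineLabel m n j + lineLabel m n (-j) = 1 := by
  obtain ⟨k, hk, h⟩ := exists_index hn hmn j
  have h' := h
  obtain ⟨c, hc⟩ := h'
  have hk0 : k ≠ 0 := by
    rintro rfl
    exact hj ⟨2 * c, by push_cast at hc; linear_combination 2 * hc⟩
  have hk2 : 2 * k ≠ n := by
    intro hk2
    have : (n : ℤ) = 2 * k := by exact_mod_cast hk2.symm
    exact hj ⟨2 * c + m, by linear_combination 2 * hc - m * this⟩
  rw [lineLabel_eq hmn hk h, lineLabel_eq hmn (k := n - k) (by omega)]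
  · rw [← Nat.cast_add, ZMod.natCast_eq_one_iff_odd, Nat.odd_iff]
    omega
  · refine ⟨-c - m, ?_⟩
    rw [Nat.cast_sub (by omega)]
    linear_combination -hc

/-- The sum of the labels of the two segments of the path of the ball that cross at `(x, y)`. -/
def crossing (m n : ℕ) (x y : ℤ) : ZMod 2 :=
  lineLabel m n ((x - y) / 2) + lineLabel m n ((-x - y) / 2)

lemma crossing_wave (m n : ℕ) (x y : ℤ) :
    crossing m n (x + 1) y + crossing m n (x - 1) y + crossing m n x (y + 1) +
      crossing m n x (y - 1) = 0 := by
  have e1 : (x - 1 - y) / 2 = (x - (y + 1)) / 2 := by congr 1; ring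
  have e2 : (x + 1 - y) / 2 = (x - (y - 1)) / 2 := by congr 1; ring
  have e3 : (-(x + 1) - y) / 2 = (-x - (y + 1)) / 2 := by congr 1; ring
  have e4 : (-(x - 1) - y) / 2 = (-x - (y - 1)) / 2 := by congr 1; ring
  simp only [crossing, e1, e2, e3, e4]
  generalize lineLabel m n _ = a, lineLabel m n _ = b, lineLabel m n _ = c, lineLabel m n _ = d
  linear_combination (a + b + c + d) * (CharTwo.two_eq_zero (R := ZMod 2))

lemma crossing_base {m n : ℕ} (hn : 0 < n) (hmn : Nat.Coprime m n) {x : ℤ} (h : Even x)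
    (h0 : 0 < x) (h1 : x < n) : crossing m n x 0 = 1 := by
  obtain ⟨j, rfl⟩ := h
  rw [crossing, show (j + j - 0) / 2 = j by omega, show (-(j + j) - 0) / 2 = -j by omega]
  refine lineLabel_add_neg hn hmn fun h => ?_
  have := Int.le_of_dvd (by omega) h
  omega

lemma crossing_left (m n : ℕ) (y : ℤ) : crossing m n 0 y = 0 := by
  simp [crossing, CharTwo.add_self_eq_zero]

lemma crossing_right (m n : ℕ) (y : ℤ) : crossing m n n y = 0 := by
  rw [crossing, show ((n : ℤ) - y) / 2 = (-n - y) / 2 + n by omega, lineLabel_add_self,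
    CharTwo.add_self_eq_zero]

lemma crossing_top {m n : ℕ} (hn : 0 < n) (hmn : Nat.Coprime m n) {x : ℤ} (h : Even (x + m)) :
    crossing m n x m = 0 := by
  rw [Int.even_iff] at h
  rw [crossing, show (-x - (m : ℤ)) / 2 = -m - (x - m) / 2 by omega, lineLabel_reflect hn hmn,
    CharTwo.add_self_eq_zero]

/-- Checkers at the crossings of segments with different labels. -/
def crossingSet (m n : ℕ) : Finset (Square (m - 1) (n - 1)) :=
  Finset.univ.filter fun q => IsDark q ∧ crossing m n (q.2.val + 1) (q.1.val + 1) = 1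

lemma checkerAt_crossingSet_square {m n : ℕ} {q : Square (m - 1) (n - 1)} (hq : IsDark q) :
    checkerAt (crossingSet m n) (q.2.val + 1) (q.1.val + 1) =
      crossing m n (q.2.val + 1) (q.1.val + 1) := by
  rw [checkerAt_square]
  simp only [crossingSet, Finset.mem_filter, Finset.mem_univ, true_and, hq]
  generalize crossing m n _ _ = a
  revert a
  decide

/-- The correction term cancels the value 1 of `crossing` on the base. Corners are excluded by `hc`:
a base corner has `crossing` 0, and the formula fails there. -/
lemma checkerAt_crossingSet {m n : ℕ} (hn : 0 < n) (hmn : Nat.Coprime m n) {x y : ℤ}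
    (h : Even (x + y)) (hx0 : 0 ≤ x) (hxn : x ≤ n) (hy0 : 0 ≤ y) (hym : y ≤ m)
    (hc : 0 < x ∧ x < n ∨ 0 < y ∧ y < m) :
    checkerAt (crossingSet m n) x y = crossing m n x y + if y = 0 then 1 else 0 := by
  by_cases hin : 0 < x ∧ x < n ∧ 0 < y ∧ y < m
  · obtain ⟨q, rfl, rfl⟩ := exists_square (r := m - 1) (c := n - 1) (x := x) (y := y)
      (by omega) (by omega) (by omega) (by omega)
    rw [checkerAt_crossingSet_square, if_neg (by omega), add_zero]
    rw [IsDark, Nat.even_iff]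
    rw [Int.even_iff] at h
    omega
  rw [checkerAt_outside _ _ _ (by omega)]
  rcases hy0.eq_or_lt with rfl | hy
  · rw [crossing_base hn hmn (by simpa using h) (by omega) (by omega)]
    decide
  rw [if_neg hy.ne', add_zero]
  rcases hym.eq_or_lt with rfl | hy'
  · exact (crossing_top hn hmn h).symm
  rcases hx0.eq_or_lt with rfl | hx
  · exact (crossing_left m n y).symm
  obtain rfl : x = n := by omega
  exact (crossing_right m n y).symm

theorem isSolution_crossingSet {m n : ℕ} (hn : 0 < n) (hmn : Nat.Coprime m n) :
    IsSolution (bottomRowPuzzle (m - 1) (n - 1)) (crossingSet m n) := by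
  rw [isSolution_iff]
  refine ⟨fun q hq => (Finset.mem_filter.1 hq).2.1, fun x y h1 h2 h3 h4 hodd => ?_⟩
  have w := crossing_wave m n x y
  rw [Int.odd_iff] at hodd
  have ev {a b : ℤ} (h : (a + b) % 2 = 0) : Even (a + b) := Int.even_iff.2 h
  rw [checkerAt_crossingSet hn hmn (ev (by omega)), checkerAt_crossingSet hn hmn (ev (by omega)),
    checkerAt_crossingSet hn hmn (ev (by omega)), checkerAt_crossingSet hn hmn (ev (by omega)),
    if_neg (by omega : ¬ y = 0), if_neg (by omega : ¬ y + 1 = 0)]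
  · simp only [sub_eq_zero]
    linear_combination w
  all_goals omega

/-! ### The number of checkers -/

lemma mul_sub_mod_div {N c t : ℕ} (h0 : 0 < t % N) (h : t < N * c) :
    (N * c - t) % N = N - t % N ∧ (N * c - t) / N = c - 1 - t / N := by
  have hN : 0 < N := Nat.pos_of_ne_zero (by rintro rfl; simp at h)
  have hr := Nat.mod_lt t hN
  have hq : t / N < c := Nat.div_lt_of_lt_mul h
  obtain ⟨d, rfl⟩ : ∃ d, c = t / N + 1 + d := ⟨c - (t / N + 1), by omega⟩
  have e : N * (t / N + 1 + d) - t = (N - t % N) + N * d := by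
    have := Nat.mod_add_div t N
    have : N * (t / N + 1 + d) = N * (t / N) + N + N * d := by ring
    omega
  rw [e, Nat.add_mul_mod_self_left, Nat.add_mul_div_left _ _ hN, Nat.mod_eq_of_lt (by omega),
    Nat.div_eq_of_lt (by omega)]
  exact ⟨rfl, by omega⟩

lemma dvd_iff_mod_two_mul {n : ℕ} (hn : 0 < n) (t : ℕ) :
    n ∣ t ↔ t % (2 * n) = 0 ∨ t % (2 * n) = n := by
  have := dvd_iff_emod hn t
  rw [Int.natCast_dvd_natCast] at this
  rw [this]
  norm_cast

/-- The times at which the ball is in the interior of the rectangle. -/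
def interiorTimes (m n : ℕ) : Finset ℕ :=
  (Finset.Ico 1 (m * n)).filter fun t => ¬ m ∣ t ∧ ¬ n ∣ t

/-- The times, during the path of the ball and the way back, at which the ball is in the interior of
the rectangle and moves from left to right. -/
def rightwardTimes (m n : ℕ) : Finset ℕ :=
  (Finset.Ico 1 (2 * (m * n))).filter fun t => ¬ m ∣ t ∧ 0 < t % (2 * n) ∧ t % (2 * n) < n

/-- The unfolded interior even points. -/
def unfoldedPoints (m n : ℕ) : Finset (ℕ × ℕ) :=
  (Finset.Ico 1 n ×ˢ Finset.Ico 1 (2 * m)).filter fun p => p.2 ≠ m ∧ Even (p.1 + p.2)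

/-- Chinese remainder theorem: modulo `2mn`, a time corresponds to a pair of residues of equal
parity modulo `2n` and `2m`. -/
lemma sum_rightwardTimes {m n : ℕ} (hm : 0 < m) (hn : 0 < n) (hmn : Nat.Coprime m n) :
    ∑ t ∈ rightwardTimes m n, ((min (t / (2 * m)) (n - 1 - t / (2 * m)) : ℕ) : ZMod 2) =
      ∑ p ∈ unfoldedPoints m n, lineLabel m n (((p.1 : ℤ) - p.2) / 2) := by
  refine Finset.sum_nbij (fun t => (t % (2 * n), t % (2 * m))) ?_ ?_ ?_ ?_
  · intro t ht
    simp only [rightwardTimes, unfoldedPoints, Finset.mem_filter, Finset.mem_Ico,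
      Finset.mem_product, dvd_iff_mod_two_mul hm] at ht ⊢
    have := Nat.mod_lt t (by omega : 2 * m > 0)
    refine ⟨by omega, by omega, ?_⟩
    rw [Nat.even_iff, Nat.add_mod, Nat.mod_mul_right_mod, Nat.mod_mul_right_mod]
    omega
  · intro s hs t ht hst
    simp only [rightwardTimes, Finset.coe_filter, Finset.mem_Ico, Set.mem_ofPred_eq] at hs ht
    simp only [Prod.mk.injEq] at hst
    have h1 : ((2 * n : ℕ) : ℤ) ∣ s - t := (Nat.modEq_iff_dvd.1 (Eq.symm hst.1 : t ≡ s [MOD _]))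
    have h2 : ((2 * m : ℕ) : ℤ) ∣ s - t := (Nat.modEq_iff_dvd.1 (Eq.symm hst.2 : t ≡ s [MOD _]))
    obtain ⟨u, hu⟩ : (2 : ℤ) ∣ s - t := dvd_trans ⟨n, by push_cast; ring⟩ h1
    rw [hu] at h1 h2
    push_cast at h1 h2
    have h3 := Int.dvd_of_mul_dvd_mul_left (by norm_num) h1
    have h4 := Int.dvd_of_mul_dvd_mul_left (by norm_num) h2
    have h5 : ((m * n : ℕ) : ℤ) ∣ u := by
      push_cast
      exact (Nat.isCoprime_iff_coprime.2 hmn).mul_dvd h4 h3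
    have : u = 0 := by
      refine Int.eq_zero_of_abs_lt_dvd h5 ?_
      rw [abs_lt]
      constructor <;> omega
    omega
  · rintro ⟨x, y⟩ hp
    simp only [unfoldedPoints, Finset.coe_filter, Finset.mem_product, Finset.mem_Ico,
      Set.mem_ofPred_eq] at hp
    obtain ⟨⟨hx, hy⟩, hym, he⟩ := hp
    obtain ⟨k, hk, c, hc⟩ := exists_index hn hmn (((x : ℤ) - y) / 2)
    have e2 : (2 * m * k + y) % (2 * m) = y := by
      rw [Nat.mul_add_mod, Nat.mod_eq_of_lt hy.2]
    have e1 : (2 * m * k + y) % (2 * n) = x := by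
      have : 2 * m * k + y ≡ x [MOD 2 * n] := by
        rw [Nat.modEq_iff_dvd]
        refine ⟨c, ?_⟩
        rw [Nat.even_iff] at he
        have : 2 * (((x : ℤ) - y) / 2) = x - y := by omega
        push_cast
        linear_combination 2 * hc - this
      rw [this, Nat.mod_eq_of_lt (by omega)]
    -- The line through the point gives the quotient `k` by `2m`, and `y` is the remainder.
    refine ⟨2 * m * k + y, ?_, by simp only [e1, e2]⟩
    simp only [rightwardTimes, Finset.coe_filter, Finset.mem_Ico, Set.mem_ofPred_eq,
      dvd_iff_mod_two_mul hm, e1, e2]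
    refine ⟨⟨by omega, ?_⟩, by omega, by omega, by omega⟩
    obtain ⟨d, rfl⟩ : ∃ d, n = k + 1 + d := ⟨n - (k + 1), by omega⟩
    have : 2 * (m * (k + 1 + d)) = 2 * m * k + 2 * m + 2 * m * d := by ring
    omega
  · intro t ht
    simp only [rightwardTimes, Finset.mem_filter, Finset.mem_Ico] at ht
    rw [lineLabel_eq hmn (k := t / (2 * m)) (Nat.div_lt_of_lt_mul (by linarith [ht.1.2]))]
    refine ⟨-(t / (2 * n) : ℕ), ?_⟩
    have e1 : ((t % (2 * n) : ℕ) : ℤ) + 2 * n * (t / (2 * n) : ℕ) = t := by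
      exact_mod_cast Nat.mod_add_div t (2 * n)
    have e2 : ((t % (2 * m) : ℕ) : ℤ) + 2 * m * (t / (2 * m) : ℕ) = t := by
      exact_mod_cast Nat.mod_add_div t (2 * m)
    rw [show ((t % (2 * n) : ℕ) : ℤ) - (t % (2 * m) : ℕ) =
      2 * (m * (t / (2 * m) : ℕ) - n * (t / (2 * n) : ℕ)) by linear_combination e1 - e2,
      Int.mul_ediv_cancel_left _ (by norm_num)]
    ring

/-- At `t` and `2mn - t` the ball is at the same point with opposite directions, so exactly one of
them is rightward. The minimum is the quotient at whichever time precedes `mn`. -/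
lemma sum_interiorTimes {m n : ℕ} (hm : 0 < m) (hn : 0 < n) :
    ∑ t ∈ rightwardTimes m n, ((min (t / (2 * m)) (n - 1 - t / (2 * m)) : ℕ) : ZMod 2) =
      ∑ t ∈ interiorTimes m n, ((t / (2 * m) : ℕ) : ZMod 2) := by
  have en : 2 * (m * n) = 2 * n * m := by ring
  have em : 2 * (m * n) = 2 * m * n := by ring
  refine Finset.sum_nbij (fun t => if t < m * n then t else 2 * (m * n) - t) ?_ ?_ ?_ ?_
  · intro t ht
    simp only [rightwardTimes, interiorTimes, Finset.mem_filter, Finset.mem_Ico] at ht ⊢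
    obtain ⟨⟨h1, h2⟩, h3, h4, h5⟩ := ht
    have h6 : ¬ n ∣ t := by rw [dvd_iff_mod_two_mul hn]; omega
    have h7 : t ≠ m * n := by rintro rfl; exact h3 (Dvd.intro _ rfl)
    split_ifs with h
    · exact ⟨⟨h1, h⟩, h3, h6⟩
    · refine ⟨by omega, ?_, ?_⟩
      · rwa [Nat.dvd_sub_iff_right h2.le ((dvd_mul_right m n).mul_left 2)]
      · rwa [Nat.dvd_sub_iff_right h2.le ((dvd_mul_left n m).mul_left 2)]
  · have aux (s t : ℕ) (h0 : 0 < s % (2 * n)) (h1 : s % (2 * n) < n) (h2 : t % (2 * n) < n)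
        (h3 : s < 2 * (m * n)) : t ≠ 2 * (m * n) - s := by
      rintro rfl
      rw [en, (mul_sub_mod_div h0 (by omega)).1] at h2
      omega
    intro s hs t ht hst
    simp only [rightwardTimes, Finset.coe_filter, Finset.mem_Ico, Set.mem_ofPred_eq] at hs ht
    have a1 := aux s t (by omega) (by omega) (by omega) (by omega)
    have a2 := aux t s (by omega) (by omega) (by omega) (by omega)
    dsimp only at hst
    split_ifs at hst <;> omega
  · intro t ht
    simp only [interiorTimes, Finset.coe_filter, Finset.mem_Ico, Set.mem_ofPred_eq] at ht
    obtain ⟨⟨h1, h2⟩, h3, h4⟩ := ht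
    have h6 := h4
    rw [dvd_iff_mod_two_mul hn] at h6
    by_cases h : t % (2 * n) < n
    · refine ⟨t, ?_, if_pos h2⟩
      simp only [rightwardTimes, Finset.coe_filter, Finset.mem_Ico, Set.mem_ofPred_eq]
      exact ⟨by omega, h3, by omega, h⟩
    · refine ⟨2 * (m * n) - t, ?_, by dsimp only; rw [if_neg (by omega)]; omega⟩
      have e := (mul_sub_mod_div (N := 2 * n) (c := m) (t := t) (by omega) (by omega)).1
      have := Nat.mod_lt t (by omega : 2 * n > 0)
      simp only [rightwardTimes, Finset.coe_filter, Finset.mem_Ico, Set.mem_ofPred_eq]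
      refine ⟨by omega, ?_, by rw [en, e]; omega, by rw [en, e]; omega⟩
      rwa [Nat.dvd_sub_iff_right (by omega)
        ((dvd_mul_right m n).mul_left 2)]
  · intro t ht
    simp only [rightwardTimes, Finset.mem_filter, Finset.mem_Ico, dvd_iff_mod_two_mul hm] at ht
    have e := (mul_sub_mod_div (N := 2 * m) (c := n) (t := t) (by omega) (by omega)).2
    have hd := Nat.div_mul_le_self t (2 * m)
    have hlt := Nat.lt_div_mul_add (a := t) (b := 2 * m) (by omega)
    congr 1
    split_ifs with h
    · have : 2 * (t / (2 * m)) < n := by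
        by_contra! hc
        have := Nat.mul_le_mul_left m hc
        have : t / (2 * m) * (2 * m) = m * (2 * (t / (2 * m))) := by ring
        omega
      omega
    · rw [em, e]
      have : n < 2 * (t / (2 * m) + 1) := by
        by_contra! hc
        have := Nat.mul_le_mul_left m hc
        have : t / (2 * m) * (2 * m) + 2 * m = m * (2 * (t / (2 * m) + 1)) := by ring
        omega
      omega

/-- Mod 2, a dark square contributes the sum of its two labels; reflection in the top side moves the
second one to the unfolded point `(x, 2m - y)`. -/
lemma card_crossingSet {m n : ℕ} (hn : 0 < n) (hmn : Nat.Coprime m n) :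
    ((crossingSet m n).card : ZMod 2) =
      ∑ p ∈ unfoldedPoints m n, lineLabel m n (((p.1 : ℤ) - p.2) / 2) := by
  set G : ℕ → ℕ → ZMod 2 :=
    fun x y => if Even (x + y) then lineLabel m n (((x : ℤ) - y) / 2) else 0 with hG
  have pts : ∑ p ∈ unfoldedPoints m n, lineLabel m n (((p.1 : ℤ) - p.2) / 2) =
      ∑ x ∈ Finset.Ico 1 n, ∑ y ∈ Finset.Ico 1 m, (G x y + G x (2 * m - y)) := by
    rw [unfoldedPoints, ← Finset.filter_filter, Finset.sum_filter, Finset.sum_filter,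
      Finset.sum_product]
    refine Finset.sum_congr rfl fun x _ => ?_
    change ∑ y ∈ Finset.Ico 1 (2 * m), (if y ≠ m then G x y else 0) = _
    rw [← Finset.sum_filter, Finset.sum_add_distrib]
    have : (Finset.Ico 1 (2 * m)).filter (fun y => y ≠ m) =
        Finset.Ico 1 m ∪ Finset.Ico (m + 1) (2 * m) := by
      ext y
      simp only [Finset.mem_filter, Finset.mem_union, Finset.mem_Ico]
      omega
    rw [this, Finset.sum_union]
    · congr 1
      refine Finset.sum_nbij' (2 * m - ·) (2 * m - ·) ?_ ?_ ?_ ?_ ?_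
      all_goals intro y hy
      all_goals simp only [Finset.mem_Ico] at hy ⊢
      · omega
      · omega
      · omega
      · omega
      · congr 1; omega
    · rw [Finset.disjoint_left]
      intro y
      simp only [Finset.mem_Ico]
      omega
  have term (q : Square (m - 1) (n - 1)) : (if q ∈ crossingSet m n then (1 : ZMod 2) else 0) =
      G (1 + q.2.val) (1 + q.1.val) + G (1 + q.2.val) (2 * m - (1 + q.1.val)) := by
    have := q.1.isLt
    by_cases hq : IsDark q
    · rw [← checkerAt_square, checkerAt_crossingSet_square hq, crossing]
      rw [IsDark, Nat.even_iff] at hq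
      simp only [hG]
      rw [if_pos (by rw [Nat.even_iff]; omega), if_pos (by rw [Nat.even_iff]; omega)]
      congr 1
      · congr 1; push_cast; omega
      · rw [← lineLabel_reflect hn hmn]
        congr 1
        push_cast [Nat.cast_sub (by omega : 1 + q.1.val ≤ 2 * m)]
        omega
    · have : q ∉ crossingSet m n := fun h => hq (Finset.mem_filter.1 h).2.1
      rw [if_neg this]
      rw [IsDark, Nat.even_iff] at hq
      simp only [hG]
      rw [if_neg (by rw [Nat.even_iff]; omega), if_neg (by rw [Nat.even_iff]; omega), add_zero]
  rw [pts, Finset.sum_comm]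
  have : ((crossingSet m n).card : ZMod 2) =
      ∑ q, if q ∈ crossingSet m n then (1 : ZMod 2) else 0 := by
    simp
  rw [this, Finset.sum_congr rfl fun q _ => term q, Fintype.sum_prod_type,
    Finset.sum_Ico_eq_sum_range,
    ← Fin.sum_univ_eq_sum_range]
  refine Finset.sum_congr rfl fun i _ => ?_
  rw [Finset.sum_Ico_eq_sum_range, ← Fin.sum_univ_eq_sum_range]

/-! ### Floor sums and their parities -/

lemma sum_range_mul_not_dvd (m n : ℕ) (hm : 0 < m) :
    ∑ t ∈ Finset.range (m * n), (if ¬ m ∣ t then t / (2 * m) else 0) =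
      (m - 1) * ∑ i ∈ Finset.range n, i / 2 := by
  induction n with
  | zero => simp
  | succ n ih =>
    rw [Nat.mul_succ, Finset.sum_range_add, ih, Finset.sum_range_succ, mul_add]
    congr 1
    have (r : ℕ) (hr : r ∈ Finset.range m) :
        (if ¬ m ∣ m * n + r then (m * n + r) / (2 * m) else 0) = if r ≠ 0 then n / 2 else 0 := by
      rw [Finset.mem_range] at hr
      have h1 : m ∣ m * n + r ↔ r = 0 := by
        rw [Nat.dvd_add_right (Dvd.intro _ rfl)]
        exact ⟨fun h => Nat.eq_zero_of_dvd_of_lt h hr, fun h => h ▸ dvd_zero _⟩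
      have h2 : (m * n + r) / (2 * m) = n / 2 := by
        rw [mul_comm 2 m, ← Nat.div_div_eq_div_mul, Nat.mul_add_div hm, Nat.div_eq_of_lt hr,
          add_zero]
      simp only [h1, h2, ne_eq]
    rw [Finset.sum_congr rfl this, ← Finset.sum_filter, Finset.sum_const, smul_eq_mul]
    congr 1
    rw [Finset.filter_ne', Finset.card_erase_of_mem (Finset.mem_range.2 hm), Finset.card_range]

/-- The second sum restores the times `nj`, the multiples of `n` that are not multiples of `m`. -/
lemma sum_interiorTimes_add {m n : ℕ} (hm : 0 < m) (hn : 0 < n) (hmn : Nat.Coprime m n) :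
    ∑ t ∈ interiorTimes m n, t / (2 * m) + ∑ j ∈ Finset.Ico 1 m, n * j / (2 * m) =
      (m - 1) * ∑ i ∈ Finset.range n, i / 2 := by
  rw [← sum_range_mul_not_dvd m n hm, ← Finset.sum_filter,
    ← Finset.sum_filter_add_sum_filter_not (Finset.filter _ _) (fun t => ¬ n ∣ t)]
  congr 1
  · refine Finset.sum_congr ?_ fun _ _ => rfl
    ext t
    simp only [interiorTimes, Finset.mem_filter, Finset.mem_Ico, Finset.mem_range]
    constructor
    · tauto
    · rintro ⟨⟨h1, h2⟩, h3⟩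
      refine ⟨⟨Nat.one_le_iff_ne_zero.2 ?_, h1⟩, h2, h3⟩
      rintro rfl
      simp at h2
  · refine Finset.sum_nbij' (n * ·) (· / n) ?_ ?_ ?_ ?_ fun _ _ => rfl
    all_goals intro t ht
    all_goals simp only [Finset.mem_filter, Finset.mem_Ico, Finset.mem_range, not_not] at ht ⊢
    · refine ⟨⟨by nlinarith, fun h => ?_⟩, Dvd.intro _ rfl⟩
      have := Nat.le_of_dvd (by omega) (hmn.dvd_of_dvd_mul_left h)
      omega
    · obtain ⟨⟨h1, h2⟩, j, rfl⟩ := ht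
      rw [Nat.mul_div_cancel_left _ hn]
      refine ⟨Nat.one_le_iff_ne_zero.2 ?_, by nlinarith⟩
      rintro rfl
      simp at h2
    · exact Nat.mul_div_cancel_left _ hn
    · exact Nat.mul_div_cancel' ht.2

/-- Counting the lattice points in a rectangle below and above its diagonal. -/
lemma sum_bounceIndices_add {m n : ℕ} (hm : 0 < m) (hn : 0 < n) (hmn : Nat.Coprime m n) :
    ∑ k ∈ bounceIndices n, 2 * m * k / n + ∑ j ∈ Finset.Ico 1 m, n * j / (2 * m) =
      (m - 1) * (bounceIndices n).card := by
  -- No lattice point lies on the diagonal, since `m` would divide `j`.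
  have ne (k j : ℕ) (hj : j ∈ Finset.Ico 1 m) : n * j ≠ 2 * m * k := by
    intro h
    rw [Finset.mem_Ico] at hj
    have : m ∣ n * j := ⟨2 * k, by rw [h]; ring⟩
    have := Nat.le_of_dvd (by omega) (hmn.dvd_of_dvd_mul_left this)
    omega
  have h1 (k : ℕ) (hk : k ∈ bounceIndices n) :
      2 * m * k / n = ∑ j ∈ Finset.Ico 1 m, if n * j < 2 * m * k then 1 else 0 := by
    rw [← Finset.card_filter]
    have : (Finset.Ico 1 m).filter (fun j => n * j < 2 * m * k) =
        Finset.Ico 1 (2 * m * k / n + 1) := by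
      ext j
      simp only [Finset.mem_filter]
      constructor
      · rintro ⟨h1, h2⟩
        rw [Finset.mem_Ico] at h1 ⊢
        exact ⟨h1.1, Nat.lt_succ_of_le ((Nat.le_div_iff_mul_le hn).2 (by linarith))⟩
      · intro h
        rw [Finset.mem_Ico] at h
        have h3 := (Nat.le_div_iff_mul_le hn).1 (Nat.le_of_lt_succ h.2)
        simp only [bounceIndices, Finset.mem_filter] at hk
        -- As `2k < n`, the diagonal stays below height `m`, so the bound on `j` cuts nothing off.
        have h4 : j < m := by
          by_contra! hc
          have := Nat.mul_le_mul_right n hc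
          have : 2 * m * k < m * n := by nlinarith
          omega
        have h5 : j ∈ Finset.Ico 1 m := Finset.mem_Ico.2 ⟨h.1, h4⟩
        exact ⟨h5, lt_of_le_of_ne (by linarith) (ne k j h5)⟩
    rw [this, Nat.card_Ico, Nat.add_sub_cancel]
  have h2 (j : ℕ) (hj : j ∈ Finset.Ico 1 m) :
      n * j / (2 * m) = ∑ k ∈ bounceIndices n, if n * j < 2 * m * k then 0 else 1 := by
    have : (bounceIndices n).filter (fun k => ¬ n * j < 2 * m * k) =
        Finset.Ico 1 (n * j / (2 * m) + 1) := by
      ext k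
      rw [Finset.mem_filter, Finset.mem_Ico, Nat.lt_succ_iff,
        Nat.le_div_iff_mul_le (by omega : 0 < 2 * m), not_lt, mul_comm k]
      simp only [bounceIndices, Finset.mem_filter, Finset.mem_Ioo]
      constructor
      · rintro ⟨⟨h, -⟩, h'⟩
        exact ⟨h.1, h'⟩
      · rintro ⟨h, h'⟩
        rw [Finset.mem_Ico] at hj
        have : 2 * k < n := by
          by_contra! hc
          have := Nat.mul_le_mul_left m hc
          have : n * j < m * n := by nlinarith
          have : 2 * m * k = m * (2 * k) := by ring
          omega
        omega
    simp_rw [← ite_not (n * j < 2 * m * _)]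
    rw [← Finset.card_filter, this, Nat.card_Ico, Nat.add_sub_cancel]
  rw [Finset.sum_congr rfl h1, Finset.sum_congr rfl h2, Finset.sum_comm,
    ← Finset.sum_add_distrib]
  simp_rw [← Finset.sum_add_distrib]
  rw [Finset.sum_congr rfl fun j _ => Finset.sum_congr rfl fun k _ =>
    (by split_ifs <;> rfl : _ = 1)]
  simp

lemma card_bounceIndices (n : ℕ) : (bounceIndices n).card = (n - 1) / 2 := by
  have : bounceIndices n = Finset.Ico 1 ((n - 1) / 2 + 1) := by
    ext k
    simp only [bounceIndices, Finset.mem_filter, Finset.mem_Ioo, Finset.mem_Ico]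
    omega
  rw [this, Nat.card_Ico, Nat.add_sub_cancel]

lemma sum_range_odd_div_two (a : ℕ) : ∑ i ∈ Finset.range (2 * a + 1), i / 2 = a * a := by
  induction a with
  | zero => simp
  | succ a ih =>
    rw [show 2 * (a + 1) + 1 = 2 * a + 1 + 1 + 1 by ring, Finset.sum_range_succ,
      Finset.sum_range_succ, ih, show (2 * a + 1) / 2 = a by omega,
      show (2 * a + 1 + 1) / 2 = a + 1 by omega]
    ring

/-- Both sums have the same complement. For odd `m` the factor `m - 1` kills both totals; for even
`m`, `n = 2a + 1` and the other factors are `a²` and `a`, congruent mod 2. -/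
lemma sum_interiorTimes_eq_sum_bounceIndices {m n : ℕ} (hm : 0 < m) (hn : 0 < n)
    (hmn : Nat.Coprime m n) :
    ((∑ t ∈ interiorTimes m n, t / (2 * m) : ℕ) : ZMod 2) =
      ((∑ k ∈ bounceIndices n, 2 * m * k / n : ℕ) : ZMod 2) := by
  have h1 := congrArg (Nat.cast : ℕ → ZMod 2) (sum_interiorTimes_add hm hn hmn)
  have h2 := congrArg (Nat.cast : ℕ → ZMod 2) (sum_bounceIndices_add hm hn hmn)
  have h3 : (((m - 1) * ∑ i ∈ Finset.range n, i / 2 : ℕ) : ZMod 2) =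
      (((m - 1) * (bounceIndices n).card : ℕ) : ZMod 2) := by
    rw [card_bounceIndices, Nat.cast_mul, Nat.cast_mul]
    rcases Nat.even_or_odd m with h | h
    · have : Odd n := by
        rw [← Nat.not_even_iff_odd]
        intro h'
        exact absurd (Nat.dvd_gcd h.two_dvd h'.two_dvd) (by rw [hmn.gcd_eq_one]; decide)
      obtain ⟨a, rfl⟩ := this
      rw [sum_range_odd_div_two, show (2 * a + 1 - 1) / 2 = a by omega, Nat.cast_mul]
      generalize (a : ZMod 2) = b
      congr 1
      revert b
      decide
    · rw [(ZMod.natCast_eq_zero_iff_even (n := m - 1)).2 (by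
        rw [Nat.even_iff]; rw [Nat.odd_iff] at h; omega), zero_mul, zero_mul]
  rw [h3, ← h2, Nat.cast_add, Nat.cast_add] at h1
  exact add_right_cancel h1

theorem mainTheorem3 (m n : ℕ) (hm : 0 < m) (hn : 0 < n) (hmn : Nat.Coprime m n) :
    (∃! C : Finset (Square (m - 1) (n - 1)), IsSolution (bottomRowPuzzle (m - 1) (n - 1)) C) ∧
    ∀ C : Finset (Square (m - 1) (n - 1)), IsSolution (bottomRowPuzzle (m - 1) (n - 1)) C →
      billiardSymbol m n = (-1) ^ C.card := by
  have hsol := isSolution_crossingSet hn hmn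
  refine ⟨⟨crossingSet m n, hsol, fun C hC => eq_of_isSolution hm hn hmn hC hsol⟩, ?_⟩
  intro C hC
  rw [eq_of_isSolution hm hn hmn hC hsol, billiardSymbol_eq hm hn hmn]
  have key : (((crossingSet m n).card : ℕ) : ZMod 2) =
      ((∑ k ∈ bounceIndices n, 2 * m * k / n : ℕ) : ZMod 2) := by
    rw [card_crossingSet hn hmn, ← sum_rightwardTimes hm hn hmn, sum_interiorTimes hm hn,
      ← Nat.cast_sum, sum_interiorTimes_eq_sum_bounceIndices hm hn hmn]
  rw [ZMod.natCast_eq_natCast_iff'] at key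
  rw [neg_one_pow_eq_pow_mod_two, ← key, ← neg_one_pow_eq_pow_mod_two]
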